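/- For $p>0$ and $x\in(0,\pi/2)$ let $$\varphi_p(x)=\left(\frac{x}{\sin x}\right)^2+\frac{x}{\tan x}-2-p\,x^4,$$ and let $A=\frac{2}{45}$, $B=\frac{4\pi^2-32}{\pi^4}$. The family $(\varphi_p)_{p>0}$ is decreasingly stratified: for every $x\in(0,\pi/2)$ and all $p_1,p_2>0$, one has $p_1<p_2$ if and only if $\varphi_{p_1}(x)>\varphi_{p_2}(x)$. For every $p>0$ the left limit $\varphi_p(\pi/2-)=\lim_{x\to\pi/2-}\varphi_p(x)$ exists and is finite, and for every $p\in(A,B)$ the function $\varphi_p$ attains its minimum on $(0,\pi/2)$ at a point $t^{(p)}$, which is the only local extremum of $\varphi_p$ on $(0,\pi/2)$. Moreover: (iv) There is exactly one $p_0\in(A,B)$ with $$\left|\varphi_{p_0}\left(t^{(p_0)}\right)\right|=\varphi_{p_0}\left(\tfrac{\pi}{2}-\right),$$ and $p_0=0.072425\ldots$, that is, $0.072425\le p_0<0.072426$. The common value $d_0=\left|\varphi_{p_0}(t^{(p_0)})\right|=\varphi_{p_0}(\pi/2-)$ satisfies $d_0=0.026471\ldots$, that is, $0.026471\le d_0<0.026472$,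 and $$d_0=\inf_{p>0}\ \sup_{x\in(0,\pi/2)}|\varphi_p(x)|.$$ (v) The function $\varphi_{p_0}$ is the minimax approximant of the family: $p_0$ is the one and only $p>0$ for which $\sup_{x\in(0,\pi/2)}|\varphi_p(x)|$ equals $d_0$. -/

import Mathlib

open Set Filter Topology

namespace Stratification

/-- A family `f p x`, with parameter `p > 0` and variable `x ∈ (a, b)`, is decreasingly
stratified. -/
def IsDecreasinglyStratified (f : ℝ → ℝ → ℝ) (a b : ℝ) : Prop :=
  ∀ x ∈ Ioo a b, ∀ p₁ > 0, ∀ p₂ > 0, (p₁ < p₂ ↔ f p₁ x > f p₂ x)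

/-- `t` is a minimum point of `h` on `(a, b)` and the only local extremum of `h` there. -/
def IsOnlyExtremumAndMin (h : ℝ → ℝ) (a b t : ℝ) : Prop :=
  t ∈ Ioo a b ∧ IsMinOn h (Ioo a b) t ∧ ∀ s ∈ Ioo a b, IsLocalExtr h s → s = t

/-- The error `sup_{x ∈ (a, b)} |f p x|` of the member `f p`. It is an extended real, so that it is
`⊤` when `f p` is unbounded. -/
noncomputable def error (f : ℝ → ℝ → ℝ) (a b p : ℝ) : EReal :=
  ⨆ x ∈ Ioo a b, ((|f p x| : ℝ) : EReal)

/-- The infimum of the errors over all positive parameters. -/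
noncomputable def infError (f : ℝ → ℝ → ℝ) (a b : ℝ) : EReal :=
  ⨅ p ∈ Ioi (0 : ℝ), error f a b p

/-- `f p₀` is the minimax approximant: `p₀` is the one and only positive parameter at which the
infimum of the errors is attained. -/
def IsMinimaxApproximant (f : ℝ → ℝ → ℝ) (a b p₀ : ℝ) : Prop :=
  0 < p₀ ∧ ∀ p > 0, (error f a b p = infError f a b ↔ p = p₀)

/-- The family `φ_p(x) = (x / sin x)² + x / tan x - 2 - p x⁴`, considered on `(0, π/2)`. -/
noncomputable def phi (p x : ℝ) : ℝ :=
  (x / Real.sin x) ^ 2 + x / Real.tan x - 2 - p * x ^ 4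

/-- The lower end of the parameter range. -/
noncomputable def A : ℝ := 2 / 45

/-- The upper end of the parameter range. -/
noncomputable def B : ℝ := (4 * Real.pi ^ 2 - 32) / Real.pi ^ 4

end Stratification

namespace Stratification

/-! Write a_n = ((n+1)π)². Partial fractions of cot and of 1/sin² give base(x) = x⁴ Σ 4/(a_n − x²)²
(`base_eq`), and differentiating in u = x⁴ gives the slope Σ 4a_n/(a_n − x²)³ (`hasDerivAt_base`),
which increases strictly. So φ_p = base − p·u is convex in u, with its only extremum where the slope
equals p. The slope tends to A at 0 and is 1/π² > B at π/2, so for p in (A, B) such a point t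
exists. The quotient base/x⁴ increases up to B at π/2, so φ_p ≤ φ_p(π/2−) for p ≤ B; it is at most
the slope, so φ_p(t) ≤ 0. Hence the error is the larger of −φ_p(t) and φ_p(π/2−). The first
increases with p, the second decreases; they cross at p₀, and any other p makes one of them worse.
The digits come from evaluating base and its tangent at one point near t. -/

/-- The squares `((n + 1) π)²` of the positive poles of the cotangent. -/
noncomputable def poleSq (n : ℕ) : ℝ := ((n + 1) * Real.pi) ^ 2

/-- `x²/sin² x + x cot x - 2`, the member of the family with parameter zero. -/
noncomputable def base (x : ℝ) : ℝ :=
  (x / Real.sin x) ^ 2 + x * Real.cos x / Real.sin x - 2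

/-- The quotient `base x / x⁴` as a series over the poles. -/
noncomputable def quotSeries (x : ℝ) : ℝ := ∑' n, 4 / (poleSq n - x ^ 2) ^ 2

/-- The derivative of `base` with respect to `x⁴` as a series over the poles. -/
noncomputable def slopeSeries (x : ℝ) : ℝ := ∑' n, 4 * poleSq n / (poleSq n - x ^ 2) ^ 3

lemma phi_eq (p x : ℝ) : phi p x = base x - p * x ^ 4 := by
  rw [phi, base, Real.tan_eq_sin_div_cos, div_div_eq_mul_div]

/-! ### Series over the poles and termwise differentiation -/

lemma hasSum_of_eq {f g : ℕ → ℝ} {a : ℝ} (h : ∀ n, f n = g n) (hg : HasSum g a) : HasSum f a :=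
  (funext h : f = g) ▸ hg

lemma hasSum_cot_poleSq {x : ℝ} (hx : x ∈ Ioo 0 Real.pi) :
    HasSum (fun n ↦ -(2 * x / (poleSq n - x ^ 2))) (Real.cos x / Real.sin x - 1 / x) := by
  obtain ⟨h0, h1⟩ := hx
  have hpi := Real.pi_pos
  have hz : ((x / Real.pi : ℝ) : ℂ) ∈ Complex.integerComplement := by
    rw [Complex.mem_integerComplement_iff]
    rintro ⟨n, hn⟩
    have hn' : (n : ℝ) = x / Real.pi := by exact_mod_cast hn
    have h2 : (0 : ℝ) < n := by rw [hn']; positivity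
    have h3 : (n : ℝ) < 1 := by rw [hn', div_lt_one hpi]; exact h1
    have h4 : 0 < n := by exact_mod_cast h2
    have h5 : n < 1 := by exact_mod_cast h3
    omega
  have h := (summable_cotTerm hz).hasSum
  rw [← cot_series_rep' hz] at h
  have h' : HasSum (fun n : ℕ ↦ 1 / (x / Real.pi - (n + 1)) + 1 / (x / Real.pi + (n + 1)))
      (Real.pi * Real.cot (Real.pi * (x / Real.pi)) - 1 / (x / Real.pi)) := by
    rw [← Complex.hasSum_ofReal]
    push_cast at h ⊢
    exact h
  have h'' := h'.mul_left Real.pi⁻¹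
  rw [Real.cot_eq_cos_div_sin, mul_div_cancel₀ _ hpi.ne'] at h''
  have hval : Real.cos x / Real.sin x - 1 / x =
      Real.pi⁻¹ * (Real.pi * (Real.cos x / Real.sin x) - 1 / (x / Real.pi)) := by
    field_simp
  rw [hval]
  refine hasSum_of_eq (fun n ↦ ?_) h''
  · have hn : (0 : ℝ) ≤ n := n.cast_nonneg
    have h2 : x - (n + 1) * Real.pi < 0 := by nlinarith
    have h3 : 0 < x + (n + 1) * Real.pi := by positivity
    have h4 : x / Real.pi - (n + 1) = (x - (n + 1) * Real.pi) / Real.pi := by field_simp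
    have h5 : x / Real.pi + (n + 1) = (x + (n + 1) * Real.pi) / Real.pi := by field_simp
    have h6 : poleSq n - x ^ 2 = -((x - (n + 1) * Real.pi) * (x + (n + 1) * Real.pi)) := by
      rw [poleSq]; ring
    rw [h4, h5, h6]
    have := h2.ne
    have := h3.ne'
    field_simp
    ring

/-- From π² ≥ 9 and x² ≤ 4. Working on (0, 2) makes π/2 an interior point, so the series also hold
there. -/
lemma poleSq_sub_ge {x : ℝ} (hx : x ∈ Ioo (0 : ℝ) 2) (n : ℕ) :
    5 * ((n : ℝ) + 1) ^ 2 ≤ poleSq n - x ^ 2 := by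
  obtain ⟨h0, h1⟩ := hx
  have hpi : 9 ≤ Real.pi ^ 2 := by nlinarith [Real.pi_gt_three]
  have hx2 : x ^ 2 ≤ 4 := by nlinarith
  have hn : 1 ≤ ((n : ℝ) + 1) ^ 2 := by nlinarith [n.cast_nonneg (α := ℝ)]
  rw [poleSq]
  nlinarith [mul_nonneg (zero_le_one.trans hn) (sub_nonneg.2 hpi)]

lemma poleSq_sub_pos {x : ℝ} (hx : x ∈ Ioo (0 : ℝ) 2) (n : ℕ) : 0 < poleSq n - x ^ 2 :=
  lt_of_lt_of_le (by positivity) (poleSq_sub_ge hx n)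

lemma poleSq_pos (n : ℕ) : 0 < poleSq n := by
  have := Real.pi_pos
  rw [poleSq]; positivity

lemma poleSq_le {x : ℝ} (hx : x ∈ Ioo (0 : ℝ) 2) (n : ℕ) : poleSq n ≤ 2 * (poleSq n - x ^ 2) := by
  have := poleSq_sub_ge hx n
  have h2 : x ^ 2 ≤ 4 := by nlinarith [hx.1, hx.2]
  nlinarith [n.cast_nonneg (α := ℝ)]

lemma Ioo_zero_two_subset : Ioo (0 : ℝ) 2 ⊆ Ioo 0 Real.pi :=
  Ioo_subset_Ioo_right (by linarith [Real.pi_gt_three])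

lemma sin_pos_of_mem {x : ℝ} (hx : x ∈ Ioo (0 : ℝ) 2) : 0 < Real.sin x :=
  Real.sin_pos_of_mem_Ioo (Ioo_zero_two_subset hx)

lemma summable_inv_succ_sq (c : ℝ) : Summable fun n : ℕ ↦ c / ((n : ℝ) + 1) ^ 2 := by
  have h := (summable_nat_add_iff 1).2 (Real.summable_one_div_nat_pow.2 one_lt_two)
  simpa [div_eq_mul_inv] using h.mul_left c

lemma hasDerivAt_cot_term {x : ℝ} (hx : x ∈ Ioo (0 : ℝ) 2) (n : ℕ) :
    HasDerivAt (fun x ↦ -(2 * x / (poleSq n - x ^ 2)))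
      (-(2 / (poleSq n - x ^ 2) + 4 * x ^ 2 / (poleSq n - x ^ 2) ^ 2)) x := by
  have h := (poleSq_sub_pos hx n).ne'
  refine (((hasDerivAt_id x).const_mul 2).div
    ((hasDerivAt_pow 2 x).const_sub (poleSq n)) h).neg.congr_deriv ?_
  simp only [id]
  field_simp
  norm_num
  ring

lemma hasDerivAt_base_term {x : ℝ} (hx : x ∈ Ioo (0 : ℝ) 2) (n : ℕ) :
    HasDerivAt (fun x ↦ x ^ 4 * (4 / (poleSq n - x ^ 2) ^ 2))
      (4 * x ^ 3 * (4 * poleSq n / (poleSq n - x ^ 2) ^ 3)) x := by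
  have h := (poleSq_sub_pos hx n).ne'
  refine ((hasDerivAt_pow 4 x).mul ((hasDerivAt_const x (4 : ℝ)).div
    (((hasDerivAt_pow 2 x).const_sub (poleSq n)).pow 2) (pow_ne_zero 2 h))).congr_deriv ?_
  simp
  field_simp
  ring

lemma quotSeries_term_le {x : ℝ} (hx : x ∈ Ioo (0 : ℝ) 2) (n : ℕ) :
    4 / (poleSq n - x ^ 2) ^ 2 ≤ 1 / ((n : ℝ) + 1) ^ 2 := by
  have h := poleSq_sub_ge hx n
  have hn : 1 ≤ ((n : ℝ) + 1) ^ 2 := by nlinarith [n.cast_nonneg (α := ℝ)]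
  rw [div_le_div_iff₀ (pow_pos (poleSq_sub_pos hx n) 2) (by positivity)]
  nlinarith

lemma slopeSeries_term_le {x : ℝ} (hx : x ∈ Ioo (0 : ℝ) 2) (n : ℕ) :
    4 * poleSq n / (poleSq n - x ^ 2) ^ 3 ≤ 2 / ((n : ℝ) + 1) ^ 2 := by
  have hp := poleSq_sub_pos hx n
  calc 4 * poleSq n / (poleSq n - x ^ 2) ^ 3
      ≤ 4 * (2 * (poleSq n - x ^ 2)) / (poleSq n - x ^ 2) ^ 3 := by
        gcongr; exact poleSq_le hx n
    _ = 2 * (4 / (poleSq n - x ^ 2) ^ 2) := by field_simp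
    _ ≤ 2 * (1 / ((n : ℝ) + 1) ^ 2) :=
        mul_le_mul_of_nonneg_left (quotSeries_term_le hx n) zero_le_two
    _ = _ := by ring

lemma summable_quotSeries {x : ℝ} (hx : x ∈ Ioo (0 : ℝ) 2) :
    Summable fun n ↦ 4 / (poleSq n - x ^ 2) ^ 2 :=
  (summable_inv_succ_sq 1).of_nonneg_of_le
    (fun n ↦ by have := poleSq_sub_pos hx n; positivity) (quotSeries_term_le hx)

lemma summable_slopeSeries {x : ℝ} (hx : x ∈ Ioo (0 : ℝ) 2) :
    Summable fun n ↦ 4 * poleSq n / (poleSq n - x ^ 2) ^ 3 :=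
  (summable_inv_succ_sq 2).of_nonneg_of_le
    (fun n ↦ by have := poleSq_sub_pos hx n; have := poleSq_pos n; positivity)
    (slopeSeries_term_le hx)

lemma hasDerivAt_cot {x : ℝ} (hx : x ∈ Ioo (0 : ℝ) 2) :
    HasDerivAt (fun x ↦ Real.cos x / Real.sin x) (-(1 / Real.sin x ^ 2)) x := by
  have h := (sin_pos_of_mem hx).ne'
  refine ((Real.hasDerivAt_cos x).div (Real.hasDerivAt_sin x) h).congr_deriv ?_
  rw [← neg_div]
  congr 1
  linear_combination -Real.sin_sq_add_cos_sq x

/-- Termwise derivative of the cotangent expansion, with signs reversed. -/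
lemma hasSum_inv_sin_sq {x : ℝ} (hx : x ∈ Ioo (0 : ℝ) 2) :
    HasSum (fun n ↦ 2 / (poleSq n - x ^ 2) + 4 * x ^ 2 / (poleSq n - x ^ 2) ^ 2)
      (1 / Real.sin x ^ 2 - 1 / x ^ 2) := by
  have hx0 := hx.1.ne'
  have hbound : ∀ (n : ℕ) (y : ℝ), y ∈ Ioo (0 : ℝ) 2 →
      ‖-(2 / (poleSq n - y ^ 2) + 4 * y ^ 2 / (poleSq n - y ^ 2) ^ 2)‖ ≤
        5 / ((n : ℝ) + 1) ^ 2 := by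
    intro n y hy
    have hp := poleSq_sub_pos hy n
    have h4 : y ^ 2 ≤ 4 := by nlinarith [hy.1, hy.2]
    have h1 : 2 / (poleSq n - y ^ 2) ≤ 1 / ((n : ℝ) + 1) ^ 2 := by
      rw [div_le_div_iff₀ hp (by positivity)]
      nlinarith [poleSq_sub_ge hy n]
    have h2 : 4 * y ^ 2 / (poleSq n - y ^ 2) ^ 2 ≤ 4 * (1 / ((n : ℝ) + 1) ^ 2) := by
      have := quotSeries_term_le hy n
      calc 4 * y ^ 2 / (poleSq n - y ^ 2) ^ 2 = y ^ 2 * (4 / (poleSq n - y ^ 2) ^ 2) := by ring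
        _ ≤ _ := by gcongr
    rw [norm_neg, Real.norm_of_nonneg (by positivity)]
    calc _ ≤ 1 / ((n : ℝ) + 1) ^ 2 + 4 * (1 / ((n : ℝ) + 1) ^ 2) := add_le_add h1 h2
      _ = _ := by ring
  have hd := hasDerivAt_tsum_of_isPreconnected (summable_inv_succ_sq 5) isOpen_Ioo
    isPreconnected_Ioo (fun n y hy ↦ hasDerivAt_cot_term hy n) hbound hx
    (hasSum_cot_poleSq (Ioo_zero_two_subset hx)).summable hx
  have he : (fun z ↦ ∑' n, -(2 * z / (poleSq n - z ^ 2))) =ᶠ[𝓝 x]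
      fun z ↦ Real.cos z / Real.sin z - z⁻¹ := by
    filter_upwards [isOpen_Ioo.mem_nhds hx] with z hz
    rw [(hasSum_cot_poleSq (Ioo_zero_two_subset hz)).tsum_eq, one_div]
  have hd' := (hasDerivAt_cot hx).sub (hasDerivAt_inv hx0)
  have hu := (hd.congr_of_eventuallyEq he.symm).unique hd'
  have hs : Summable fun n ↦ -(2 / (poleSq n - x ^ 2) + 4 * x ^ 2 / (poleSq n - x ^ 2) ^ 2) :=
    (summable_inv_succ_sq 5).of_norm_bounded fun n ↦ hbound n x hx
  have := hs.hasSum.neg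
  rw [hu] at this
  rw [show 1 / Real.sin x ^ 2 - 1 / x ^ 2 = -(-(1 / Real.sin x ^ 2) - -(x ^ 2)⁻¹) by ring]
  exact hasSum_of_eq (fun n ↦ (neg_neg _).symm) this

/-- In x²·(series of 1/sin²) + x·(series of cot) the terms 2x²/(a_n − x²) cancel. -/
lemma base_eq {x : ℝ} (hx : x ∈ Ioo (0 : ℝ) 2) : base x = x ^ 4 * quotSeries x := by
  have hx0 := hx.1.ne'
  have h := ((hasSum_inv_sin_sq hx).mul_left (x ^ 2)).add
    ((hasSum_cot_poleSq (Ioo_zero_two_subset hx)).mul_left x)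
  have h2 := (summable_quotSeries hx).hasSum.mul_left (x ^ 4)
  have he : base x =
      x ^ 2 * (1 / Real.sin x ^ 2 - 1 / x ^ 2) + x * (Real.cos x / Real.sin x - 1 / x) := by
    have := (sin_pos_of_mem hx).ne'
    rw [base]
    field_simp
    ring
  rw [he, quotSeries]
  refine h.unique (hasSum_of_eq (fun n ↦ ?_) h2)
  have := (poleSq_sub_pos hx n).ne'
  field_simp
  ring

lemma hasDerivAt_base {x : ℝ} (hx : x ∈ Ioo (0 : ℝ) 2) :
    HasDerivAt base (4 * x ^ 3 * slopeSeries x) x := by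
  have hd := hasDerivAt_tsum_of_isPreconnected (summable_inv_succ_sq 64) isOpen_Ioo
    isPreconnected_Ioo (fun n y hy ↦ hasDerivAt_base_term hy n) (fun n y hy ↦ ?_) hx
    ((summable_quotSeries hx).mul_left (x ^ 4)) hx
  · rw [tsum_mul_left] at hd
    refine hd.congr_of_eventuallyEq ?_
    filter_upwards [isOpen_Ioo.mem_nhds hx] with z hz
    rw [tsum_mul_left, base_eq hz, quotSeries]
  · have h1 := slopeSeries_term_le hy n
    have hp := poleSq_sub_pos hy n
    have hq := poleSq_pos n
    have h0 := hy.1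
    have h3 : y ^ 3 ≤ 2 ^ 3 := pow_le_pow_left₀ h0.le hy.2.le 3
    rw [Real.norm_of_nonneg (by positivity)]
    calc _ ≤ 4 * 2 ^ 3 * (2 / ((n : ℝ) + 1) ^ 2) := by gcongr
      _ = _ := by ring

/-! ### Monotonicity, comparison and convexity in x⁴ -/

lemma strictMonoOn_slopeSeries : StrictMonoOn slopeSeries (Ioo 0 2) := by
  intro x hx y hy hxy
  have hlt (n : ℕ) :
      4 * poleSq n / (poleSq n - x ^ 2) ^ 3 < 4 * poleSq n / (poleSq n - y ^ 2) ^ 3 := by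
    have hp := poleSq_sub_pos hy n
    have hq := poleSq_pos n
    have hsq : x ^ 2 < y ^ 2 := pow_lt_pow_left₀ hxy hx.1.le two_ne_zero
    gcongr
  exact (summable_slopeSeries hx).tsum_lt_tsum (fun n ↦ (hlt n).le) (hlt 0)
    (summable_slopeSeries hy)

lemma monotoneOn_quotSeries : MonotoneOn quotSeries (Ioo 0 2) := by
  intro x hx y hy hxy
  refine (summable_quotSeries hx).tsum_le_tsum (fun n ↦ ?_) (summable_quotSeries hy)
  have hp := poleSq_sub_pos hy n
  have hsq : x ^ 2 ≤ y ^ 2 := pow_le_pow_left₀ hx.1.le hxy 2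
  gcongr

lemma quotSeries_le_slopeSeries {x : ℝ} (hx : x ∈ Ioo (0 : ℝ) 2) :
    quotSeries x ≤ slopeSeries x := by
  refine (summable_quotSeries hx).tsum_le_tsum (fun n ↦ ?_) (summable_slopeSeries hx)
  have hp := poleSq_sub_pos hx n
  rw [div_le_div_iff₀ (by positivity) (by positivity)]
  nlinarith [mul_nonneg (pow_pos hp 2).le (sq_nonneg x)]

lemma hasSum_poleSq_zeta : HasSum (fun n ↦ 4 / poleSq n ^ 2) A := by
  have h := (hasSum_nat_add_iff' 1).2 hasSum_zeta_four
  have h2 := h.mul_left (4 / Real.pi ^ 4)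
  rw [show A = 4 / Real.pi ^ 4 *
      (Real.pi ^ 4 / 90 - ∑ i ∈ Finset.range 1, 1 / (i : ℝ) ^ 4) by
    have := Real.pi_ne_zero
    rw [A]; simp; field_simp; norm_num]
  refine hasSum_of_eq (fun n ↦ ?_) h2
  have := Real.pi_ne_zero
  have : (n : ℝ) + 1 ≠ 0 := by positivity
  rw [poleSq]
  push_cast
  field_simp

/-- Since a_n ≥ π², a_n − x² ≥ a_n(1 − x²/π²), and ζ(4) gives Σ 4/a_n² = A. This keeps the slope
below any p > A near 0. -/
lemma slopeSeries_le {x : ℝ} (hx : x ∈ Ioo (0 : ℝ) 2) :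
    slopeSeries x ≤ A * (1 - x ^ 2 / Real.pi ^ 2)⁻¹ ^ 3 := by
  have h := hasSum_poleSq_zeta.mul_right ((1 - x ^ 2 / Real.pi ^ 2)⁻¹ ^ 3)
  refine hasSum_le (fun n ↦ ?_) (summable_slopeSeries hx).hasSum h
  have hp := poleSq_sub_pos hx n
  have hq := poleSq_pos n
  have hpi := Real.pi_pos
  have hc : 0 < 1 - x ^ 2 / Real.pi ^ 2 := by
    rw [sub_pos, div_lt_one (by positivity)]
    exact pow_lt_pow_left₀ (Ioo_zero_two_subset hx).2 hx.1.le two_ne_zero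
  have hle : poleSq n * (1 - x ^ 2 / Real.pi ^ 2) ≤ poleSq n - x ^ 2 := by
    have he : poleSq n * (1 - x ^ 2 / Real.pi ^ 2) = poleSq n - ((n : ℝ) + 1) ^ 2 * x ^ 2 := by
      rw [poleSq]; field_simp
    rw [he]
    nlinarith [sq_nonneg x, mul_nonneg n.cast_nonneg (sq_nonneg x),
      mul_nonneg (sq_nonneg (n : ℝ)) (sq_nonneg x)]
  calc 4 * poleSq n / (poleSq n - x ^ 2) ^ 3
      ≤ 4 * poleSq n / (poleSq n * (1 - x ^ 2 / Real.pi ^ 2)) ^ 3 := by gcongr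
    _ = _ := by rw [mul_pow, inv_pow]; field_simp

/-- The derivative of `base` in trigonometric form. -/
lemma slopeSeries_eq {x : ℝ} (hx : x ∈ Ioo (0 : ℝ) 2) :
    4 * x ^ 3 * slopeSeries x = x / Real.sin x ^ 2 + Real.cos x / Real.sin x
      - 2 * x ^ 2 * Real.cos x / Real.sin x ^ 3 := by
  have hs := (sin_pos_of_mem hx).ne'
  refine (hasDerivAt_base hx).unique ?_
  have h := ((((hasDerivAt_id x).div (Real.hasDerivAt_sin x) hs).pow 2).add
    (((hasDerivAt_id x).mul (Real.hasDerivAt_cos x)).div (Real.hasDerivAt_sin x) hs)).sub_const 2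
  refine h.congr_deriv ?_
  have hc : Real.cos x ^ 2 = 1 - Real.sin x ^ 2 := by
    linear_combination Real.sin_sq_add_cos_sq x
  simp only [id, Pi.mul_apply, Pi.div_apply, show 2 - 1 = 1 from rfl, pow_one]
  push_cast
  field_simp
  simp only [hc]
  ring

lemma continuousOn_slopeSeries : ContinuousOn slopeSeries (Ioo 0 2) := by
  have h : ContinuousOn (fun x ↦ (x / Real.sin x ^ 2 + Real.cos x / Real.sin x
      - 2 * x ^ 2 * Real.cos x / Real.sin x ^ 3) / (4 * x ^ 3)) (Ioo 0 2) := by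
    have hs : ∀ x ∈ Ioo (0 : ℝ) 2, Real.sin x ≠ 0 := fun x hx ↦ (sin_pos_of_mem hx).ne'
    have h0 : ∀ x ∈ Ioo (0 : ℝ) 2, 4 * x ^ 3 ≠ 0 := fun x hx ↦ by
      have := hx.1; positivity
    fun_prop (disch := first | assumption | (intro x hx; exact pow_ne_zero _ (hs x hx)))
  refine h.congr fun x hx ↦ ?_
  have := hx.1.ne'
  simp only [← slopeSeries_eq hx]
  field_simp

/-- `base` as a function of `x⁴` lies above its tangents. -/
lemma tangent_le_base {x y : ℝ} (hx : x ∈ Ioo (0 : ℝ) 2) (hy : y ∈ Ioo (0 : ℝ) 2) :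
    base y + slopeSeries y * (x ^ 4 - y ^ 4) ≤ base x := by
  -- The derivative of base minus its tangent has the sign of z − y.
  have hd : ∀ z ∈ Ioo (0 : ℝ) 2, HasDerivAt (fun z ↦ base z - slopeSeries y * z ^ 4)
      (4 * z ^ 3 * (slopeSeries z - slopeSeries y)) z := fun z hz ↦
    ((hasDerivAt_base hz).sub ((hasDerivAt_pow 4 z).const_mul _)).congr_deriv (by norm_num; ring)
  have hcont : ContinuousOn (fun z ↦ base z - slopeSeries y * z ^ 4) (Ioo 0 2) :=
    fun z hz ↦ (hd z hz).continuousAt.continuousWithinAt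
  suffices h : base y - slopeSeries y * y ^ 4 ≤ base x - slopeSeries y * x ^ 4 by linarith
  rcases le_total x y with hxy | hxy
  · have hsub : Icc x y ⊆ Ioo 0 2 := fun z hz ↦ ⟨hx.1.trans_le hz.1, hz.2.trans_lt hy.2⟩
    refine antitoneOn_of_hasDerivWithinAt_nonpos (convex_Icc x y) (hcont.mono hsub)
      (fun z hz ↦ (hd z (hsub (interior_subset hz))).hasDerivWithinAt) (fun z hz ↦ ?_)
      (left_mem_Icc.2 hxy) (right_mem_Icc.2 hxy) hxy
    have hz' := interior_subset hz
    have := (hsub hz').1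
    exact mul_nonpos_of_nonneg_of_nonpos (by positivity)
      (sub_nonpos.2 (strictMonoOn_slopeSeries.monotoneOn (hsub hz') hy hz'.2))
  · have hsub : Icc y x ⊆ Ioo 0 2 := fun z hz ↦ ⟨hy.1.trans_le hz.1, hz.2.trans_lt hx.2⟩
    refine monotoneOn_of_hasDerivWithinAt_nonneg (convex_Icc y x) (hcont.mono hsub)
      (fun z hz ↦ (hd z (hsub (interior_subset hz))).hasDerivWithinAt) (fun z hz ↦ ?_)
      (left_mem_Icc.2 hxy) (right_mem_Icc.2 hxy) hxy
    have hz' := interior_subset hz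
    have := (hsub hz').1
    exact mul_nonneg (by positivity)
      (sub_nonneg.2 (strictMonoOn_slopeSeries.monotoneOn hy (hsub hz') hz'.1))

/-! ### Numerical enclosures at 1.247008 -/

lemma abs_cos_sin_sub_taylor_le {y : ℝ} (h0 : 0 ≤ y) (h1 : y ≤ 1) :
    |Real.cos y - (1 - y ^ 2 / 2 + y ^ 4 / 24 - y ^ 6 / 720 + y ^ 8 / 40320 - y ^ 10 / 3628800
      + y ^ 12 / 479001600)| ≤ y ^ 14 / 10 ^ 10 ∧
    |Real.sin y - (y - y ^ 3 / 6 + y ^ 5 / 120 - y ^ 7 / 5040 + y ^ 9 / 362880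
      - y ^ 11 / 39916800 + y ^ 13 / 6227020800)| ≤ y ^ 14 / 10 ^ 10 := by
  have hn : ‖(y : ℂ) * Complex.I‖ = y := by simp [abs_of_nonneg h0]
  -- Both expansions are read off exp(iy); the remainder constant 15/(14!·14) is below 10⁻¹⁰.
  have h := Complex.exp_bound (x := y * Complex.I) (by rw [hn]; exact h1) (n := 14) (by norm_num)
  rw [hn] at h
  have hle : y ^ 14 * (((14 : ℕ).succ : ℝ) * ((Nat.factorial 14 : ℝ) * (14 : ℕ))⁻¹)
      ≤ y ^ 14 / 10 ^ 10 := by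
    rw [div_eq_mul_inv]
    gcongr
    norm_num [Nat.factorial]
  have key : Complex.exp (y * Complex.I) -
      ∑ m ∈ Finset.range 14, ((y : ℂ) * Complex.I) ^ m / m.factorial =
      ⟨Real.cos y - (1 - y ^ 2 / 2 + y ^ 4 / 24 - y ^ 6 / 720 + y ^ 8 / 40320
      - y ^ 10 / 3628800 + y ^ 12 / 479001600), Real.sin y - (y - y ^ 3 / 6 + y ^ 5 / 120
      - y ^ 7 / 5040 + y ^ 9 / 362880 - y ^ 11 / 39916800 + y ^ 13 / 6227020800)⟩ := by
    have I3 : Complex.I ^ 3 = -Complex.I := by rw [pow_succ, Complex.I_sq]; ring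
    have I4 : Complex.I ^ 4 = 1 := Complex.I_pow_four
    have I5 : Complex.I ^ 5 = Complex.I := by rw [pow_succ, I4]; ring
    have I6 : Complex.I ^ 6 = -1 := by rw [pow_succ, I5]; exact Complex.I_mul_I
    have I7 : Complex.I ^ 7 = -Complex.I := by rw [pow_succ, I6]; ring
    have I8 : Complex.I ^ 8 = 1 := by rw [show 8 = 4 * 2 by rfl, pow_mul, I4, one_pow]
    have I9 : Complex.I ^ 9 = Complex.I := by rw [pow_succ, I8]; ring
    have I10 : Complex.I ^ 10 = -1 := by rw [pow_succ, I9]; exact Complex.I_mul_I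
    have I11 : Complex.I ^ 11 = -Complex.I := by rw [pow_succ, I10]; ring
    have I12 : Complex.I ^ 12 = 1 := by rw [show 12 = 4 * 3 by rfl, pow_mul, I4, one_pow]
    have I13 : Complex.I ^ 13 = Complex.I := by rw [pow_succ, I12]; ring
    rw [Complex.exp_mul_I, Complex.mk_eq_add_mul_I]
    simp only [Finset.sum_range_succ, Finset.sum_range_zero, mul_pow, Complex.I_sq, I3, I4, I5, I6,
      I7, I8, I9, I10, I11, I12, I13]
    norm_num [Nat.factorial]
    ring
  rw [key] at h
  exact ⟨(Complex.abs_re_le_norm _).trans (h.trans hle),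
    (Complex.abs_im_le_norm _).trans (h.trans hle)⟩

/-- Numerical values of sine and cosine near the extremum of the minimax approximant. -/
lemma sin_cos_bounds :
    Real.sin 1.247008 ∈ Icc (0.94803692855 : ℝ) 0.94803692860 ∧ Real.cos 1.247008 ∈ Icc (0.31816030872 : ℝ) 0.31816030877 := by
  -- The Taylor bound needs y ≤ 1, hence half the angle and the duplication formulas.
  obtain ⟨hc, hs⟩ := abs_cos_sin_sub_taylor_le (y := 0.623504) (by norm_num) (by norm_num)
  rw [abs_le] at hc hs
  have c1 : (0.811837517223 : ℝ) ≤ Real.cos 0.623504 := by norm_num at hc ⊢; linarith [hc.1]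
  have c2 : Real.cos 0.623504 ≤ 0.811837517226 := by norm_num at hc ⊢; linarith [hc.2]
  have s1 : (0.583883417836 : ℝ) ≤ Real.sin 0.623504 := by norm_num at hs ⊢; linarith [hs.1]
  have s2 : Real.sin 0.623504 ≤ 0.583883417839 := by norm_num at hs ⊢; linarith [hs.2]
  rw [show (1.247008 : ℝ) = 2 * 0.623504 by norm_num, Real.sin_two_mul, Real.cos_two_mul]
  generalize Real.cos 0.623504 = c at *
  generalize Real.sin 0.623504 = s at *
  refine ⟨⟨?_, ?_⟩, ?_, ?_⟩ <;> nlinarith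

lemma base_bounds : base 1.247008 ∈ Icc (0.148661504 : ℝ) 0.148661507 := by
  obtain ⟨⟨s1, s2⟩, c1, c2⟩ := sin_cos_bounds
  rw [base]
  generalize Real.cos 1.247008 = c at *
  generalize Real.sin 1.247008 = s at *
  have hs : 0 < s := by linarith
  have h1 : s⁻¹ ∈ Icc (0.94803692860 : ℝ)⁻¹ (0.94803692855 : ℝ)⁻¹ :=
    ⟨inv_anti₀ hs s2, inv_anti₀ (by norm_num) s1⟩
  have h2 : (1.247008 / s) ^ 2 + 1.247008 * c / s - 2 =
    1.247008 ^ 2 * (s⁻¹) ^ 2 + 1.247008 * (c * s⁻¹) - 2 := by ring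
  rw [h2]
  obtain ⟨h3, h4⟩ := h1
  constructor
  · calc (0.148661504 : ℝ) ≤ 1.247008 ^ 2 * ((0.94803692860 : ℝ)⁻¹) ^ 2 + 1.247008 * (0.31816030872 * (0.94803692860 : ℝ)⁻¹) - 2 := by norm_num
      _ ≤ _ := by gcongr
  · calc _ ≤ 1.247008 ^ 2 * ((0.94803692855 : ℝ)⁻¹) ^ 2 + 1.247008 * (0.31816030877 * (0.94803692855 : ℝ)⁻¹) - 2 := by gcongr
      _ ≤ 0.148661507 := by norm_num

lemma slopeSeries_bounds : slopeSeries 1.247008 ∈ Icc (0.072425231 : ℝ) 0.072425234 := by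
  have h := slopeSeries_eq (x := 1.247008) ⟨by norm_num, by norm_num⟩
  obtain ⟨⟨s1, s2⟩, c1, c2⟩ := sin_cos_bounds
  generalize Real.cos 1.247008 = c at *
  generalize Real.sin 1.247008 = s at *
  generalize slopeSeries 1.247008 = k at *
  have hs : 0 < s := by linarith
  have h3 : (0.94803692860 : ℝ)⁻¹ ≤ s⁻¹ := inv_anti₀ hs s2
  have h4 : s⁻¹ ≤ (0.94803692855 : ℝ)⁻¹ := inv_anti₀ (by norm_num) s1
  have h2 : 1.247008 / s ^ 2 + c / s - 2 * 1.247008 ^ 2 * c / s ^ 3 =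
    1.247008 * (s⁻¹) ^ 2 + c * s⁻¹ - 2 * 1.247008 ^ 2 * (c * (s⁻¹) ^ 3) := by ring
  rw [h2] at h
  have hc : 0 ≤ c := by linarith
  constructor
  · have : 1.247008 * ((0.94803692860 : ℝ)⁻¹) ^ 2 + 0.31816030872 * (0.94803692860 : ℝ)⁻¹
        - 2 * 1.247008 ^ 2 * (0.31816030877 * ((0.94803692855 : ℝ)⁻¹) ^ 3) ≤ 4 * 1.247008 ^ 3 * k := by
      rw [h]; gcongr
    norm_num at this ⊢
    linarith
  · have : 4 * 1.247008 ^ 3 * k ≤ 1.247008 * ((0.94803692855 : ℝ)⁻¹) ^ 2 + 0.31816030877 * (0.94803692855 : ℝ)⁻¹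
        - 2 * 1.247008 ^ 2 * (0.31816030872 * ((0.94803692860 : ℝ)⁻¹) ^ 3) := by
      rw [h]; gcongr
    norm_num at this ⊢
    linarith

/-! ### Behaviour at π/2, the extremum and the error -/

lemma Ioo_pi_div_two_subset : Ioo 0 (Real.pi / 2) ⊆ Ioo (0 : ℝ) 2 :=
  Ioo_subset_Ioo_right (by linarith [Real.pi_lt_four])

lemma pi_div_two_mem : Real.pi / 2 ∈ Ioo (0 : ℝ) 2 :=
  ⟨by linarith [Real.pi_pos], by linarith [Real.pi_lt_four]⟩

lemma slopeSeries_pi_div_two : slopeSeries (Real.pi / 2) = 1 / Real.pi ^ 2 := by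
  have h := slopeSeries_eq pi_div_two_mem
  have := Real.pi_ne_zero
  simp at h
  field_simp at h ⊢
  linarith

lemma base_pi_div_two : base (Real.pi / 2) = B * (Real.pi / 2) ^ 4 := by
  have := Real.pi_ne_zero
  simp [base, B]
  field_simp
  ring

lemma B_lt : B < 1 / Real.pi ^ 2 := by
  have hpi := Real.pi_pos
  have h : Real.pi < 3.15 := Real.pi_lt_d2
  rw [B, div_lt_div_iff₀ (by positivity) (by positivity)]
  have : Real.pi ^ 2 < 10 := by nlinarith
  nlinarith [pow_pos hpi 2]

/-- The increasing quotient base/x⁴ has the value B at π/2. -/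
lemma base_le {x : ℝ} (hx : x ∈ Ioo 0 (Real.pi / 2)) : base x ≤ B * x ^ 4 := by
  have hx2 := Ioo_pi_div_two_subset hx
  have h := monotoneOn_quotSeries hx2 pi_div_two_mem hx.2.le
  have hq : quotSeries (Real.pi / 2) = B := by
    have := base_eq pi_div_two_mem
    rw [base_pi_div_two, mul_comm] at this
    have hp := Real.pi_pos
    exact (mul_left_cancel₀ (by positivity) this).symm
  rw [base_eq hx2, mul_comm]
  rw [hq] at h
  have := hx.1
  gcongr

lemma exists_slopeSeries_eq {p : ℝ} (hp : p ∈ Ioo A B) :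
    ∃ t ∈ Ioo 0 (Real.pi / 2), slopeSeries t = p := by
  have hlim : Tendsto (fun x : ℝ ↦ A * (1 - x ^ 2 / Real.pi ^ 2)⁻¹ ^ 3) (𝓝[>] 0) (𝓝 A) := by
    have hc : ContinuousAt (fun x : ℝ ↦ A * (1 - x ^ 2 / Real.pi ^ 2)⁻¹ ^ 3) 0 := by
      fun_prop (disch := simp)
    have h := hc.tendsto.mono_left (nhdsWithin_le_nhds (s := Ioi 0))
    simpa using h
  have hpi : 0 < Real.pi / 2 := by linarith [Real.pi_pos]
  obtain ⟨e, he, hmem⟩ := ((hlim.eventually (gt_mem_nhds hp.1)).and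
    (Ioo_mem_nhdsGT hpi)).exists
  have h1 : slopeSeries e < p := (slopeSeries_le (Ioo_pi_div_two_subset hmem)).trans_lt he
  have h2 : p < slopeSeries (Real.pi / 2) := by
    rw [slopeSeries_pi_div_two]; exact hp.2.trans B_lt
  have hsub : Icc e (Real.pi / 2) ⊆ Ioo 0 2 := fun z hz ↦
    ⟨hmem.1.trans_le hz.1, hz.2.trans_lt pi_div_two_mem.2⟩
  obtain ⟨t, ht, hteq⟩ := intermediate_value_Ioo hmem.2.le (continuousOn_slopeSeries.mono hsub)
    ⟨h1, h2⟩
  exact ⟨t, ⟨hmem.1.trans ht.1, ht.2⟩, hteq⟩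

lemma phi_min {p t x : ℝ} (ht : t ∈ Ioo (0 : ℝ) 2) (hp : slopeSeries t = p)
    (hx : x ∈ Ioo (0 : ℝ) 2) : phi p t ≤ phi p x := by
  have := tangent_le_base hx ht
  rw [hp] at this
  rw [phi_eq, phi_eq]
  linarith

lemma isOnlyExtremumAndMin_phi {p t : ℝ} (ht : t ∈ Ioo 0 (Real.pi / 2))
    (hp : slopeSeries t = p) : IsOnlyExtremumAndMin (phi p) 0 (Real.pi / 2) t := by
  have ht2 := Ioo_pi_div_two_subset ht
  refine ⟨ht, fun x hx ↦ phi_min ht2 hp (Ioo_pi_div_two_subset hx), fun s hs hext ↦ ?_⟩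
  have hs2 := Ioo_pi_div_two_subset hs
  have hd : HasDerivAt (phi p) (4 * s ^ 3 * (slopeSeries s - p)) s := by
    rw [funext (phi_eq p)]
    exact ((hasDerivAt_base hs2).sub ((hasDerivAt_pow 4 s).const_mul p)).congr_deriv
      (by norm_num; ring)
  have h0 := hext.hasDerivAt_eq_zero hd
  have hs0 : 4 * s ^ 3 ≠ 0 := by have := hs.1; positivity
  have : slopeSeries s = slopeSeries t := by
    rw [hp]; exact sub_eq_zero.1 ((mul_eq_zero.1 h0).resolve_left hs0)
  exact strictMonoOn_slopeSeries.injOn hs2 ht2 this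

lemma phi_nonpos {p t : ℝ} (ht : t ∈ Ioo (0 : ℝ) 2) (hp : slopeSeries t = p) : phi p t ≤ 0 := by
  rw [phi_eq, base_eq ht, ← hp]
  have := quotSeries_le_slopeSeries ht
  have h4 : 0 ≤ t ^ 4 := by positivity
  nlinarith

/-- The left limit of `phi p` at `π / 2`. -/
noncomputable def endLimit (p : ℝ) : ℝ := (B - p) * (Real.pi / 2) ^ 4

lemma endLimit_eq (p : ℝ) : endLimit p = Real.pi ^ 2 / 4 - 2 - p * (Real.pi ^ 4 / 16) := by
  have := Real.pi_ne_zero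
  rw [endLimit, B]
  field_simp
  ring

lemma endLimit_lt {p q : ℝ} (h : p < q) : endLimit q < endLimit p := by
  have := Real.pi_pos
  rw [endLimit, endLimit]
  gcongr

lemma tendsto_phi (p : ℝ) : Tendsto (phi p) (𝓝[<] (Real.pi / 2)) (𝓝 (endLimit p)) := by
  have hd : ContinuousAt (phi p) (Real.pi / 2) := by
    rw [funext (phi_eq p)]
    exact (hasDerivAt_base pi_div_two_mem).continuousAt.sub (by fun_prop)
  have h := hd.tendsto.mono_left (nhdsWithin_le_nhds (s := Iio (Real.pi / 2)))
  rwa [phi_eq, base_pi_div_two, ← sub_mul] at h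

lemma phi_le_endLimit {p x : ℝ} (hp : p ≤ B) (hx : x ∈ Ioo 0 (Real.pi / 2)) :
    phi p x ≤ endLimit p := by
  have h4 : x ^ 4 ≤ (Real.pi / 2) ^ 4 := pow_le_pow_left₀ hx.1.le hx.2.le 4
  rw [phi_eq, endLimit]
  nlinarith [base_le hx, mul_le_mul_of_nonneg_left h4 (sub_nonneg.2 hp)]

lemma phi_lt_phi {p q x : ℝ} (hx : 0 < x) : p < q ↔ phi q x < phi p x := by
  rw [phi_eq, phi_eq, sub_lt_sub_iff_left, mul_lt_mul_iff_left₀ (pow_pos hx 4)]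

lemma endLimit_le_error (p : ℝ) :
    ((endLimit p : ℝ) : EReal) ≤ error phi 0 (Real.pi / 2) p := by
  have h : Tendsto (fun x ↦ ((phi p x : ℝ) : EReal)) (𝓝[<] (Real.pi / 2)) (𝓝 (endLimit p)) :=
    (continuous_coe_real_ereal.tendsto _).comp (tendsto_phi p)
  refine le_of_tendsto h ?_
  filter_upwards [Ioo_mem_nhdsLT (by linarith [Real.pi_pos] : 0 < Real.pi / 2)] with x hx
  exact (EReal.coe_le_coe_iff.2 (le_abs_self _)).trans
    (le_iSup₂ (f := fun x (_ : x ∈ Ioo 0 (Real.pi / 2)) ↦ ((|phi p x| : ℝ) : EReal)) x hx)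

lemma abs_phi_le_error {p x : ℝ} (hx : x ∈ Ioo 0 (Real.pi / 2)) :
    ((|phi p x| : ℝ) : EReal) ≤ error phi 0 (Real.pi / 2) p :=
  le_iSup₂ (f := fun x (_ : x ∈ Ioo 0 (Real.pi / 2)) ↦ ((|phi p x| : ℝ) : EReal)) x hx

/-! ### Bracketing the parameter -/

lemma pi_sq_bounds : Real.pi ^ 2 ∈ Icc (9.86960440108 : ℝ) 9.86960440109 := by
  have h1 := Real.pi_gt_d20
  have h2 := Real.pi_lt_d20
  constructor <;> nlinarith

lemma pi_four_bounds : Real.pi ^ 4 ∈ Icc (97.4090910338 : ℝ) 97.4090910343 := by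
  obtain ⟨h1, h2⟩ := pi_sq_bounds
  rw [show Real.pi ^ 4 = (Real.pi ^ 2) ^ 2 by ring]
  constructor <;> nlinarith

lemma parameter_mem {p : ℝ} (hp : p ∈ Icc (0.0724252 : ℝ) 0.072425285) : p ∈ Ioo A B := by
  obtain ⟨h1, h2⟩ := pi_sq_bounds
  obtain ⟨h3, h4⟩ := pi_four_bounds
  constructor
  · rw [A]; norm_num at hp ⊢; linarith [hp.1]
  · rw [B, lt_div_iff₀ (by linarith)]
    norm_num at *
    nlinarith [hp.1, hp.2]

/-- The tangent at 1.247008 has slope just above 0.0724252, so it bounds φ from below at every t,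
without locating the minimum. -/
lemma neg_phi_lt_endLimit {t : ℝ} (ht : t ∈ Ioo 0 (Real.pi / 2)) :
    -phi 0.0724252 t < endLimit 0.0724252 := by
  have h := tangent_le_base (x := t) (y := 1.247008) (Ioo_pi_div_two_subset ht)
    ⟨by norm_num, by norm_num⟩
  have hb := base_bounds.1
  obtain ⟨k1, k2⟩ := slopeSeries_bounds
  obtain ⟨h1, h2⟩ := pi_sq_bounds
  obtain ⟨h3, h4⟩ := pi_four_bounds
  have ht4 : 0 ≤ t ^ 4 := by positivity
  rw [phi_eq, endLimit_eq]
  norm_num at *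
  nlinarith

/-- One sample suffices here, as the minimum is no larger. -/
lemma endLimit_lt_neg_phi : endLimit 0.072425285 < -phi 0.072425285 1.247008 := by
  have hb := base_bounds.2
  obtain ⟨h1, h2⟩ := pi_sq_bounds
  obtain ⟨h3, h4⟩ := pi_four_bounds
  rw [phi_eq, endLimit_eq]
  norm_num at *
  linarith

lemma endLimit_bounds {p : ℝ} (hp : p ∈ Icc (0.0724252 : ℝ) 0.072425285) :
    0.026471 ≤ endLimit p ∧ endLimit p < 0.026472 := by
  obtain ⟨h1, h2⟩ := pi_sq_bounds
  obtain ⟨h3, h4⟩ := pi_four_bounds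
  obtain ⟨hp1, hp2⟩ := hp
  rw [endLimit_eq]
  norm_num at *
  constructor <;> nlinarith

end Stratification

open Stratification in
theorem mainTheorem9 :
    Stratification.IsDecreasinglyStratified Stratification.phi 0 (Real.pi / 2) ∧
    -- `t p` is the minimum point of `φ_p`, and `L p` is the left limit of `φ_p` at `π/2`
    ∃ t L : ℝ → ℝ,
      (∀ p ∈ Ioo Stratification.A Stratification.B,
        Stratification.IsOnlyExtremumAndMin (Stratification.phi p) 0 (Real.pi / 2) (t p)) ∧
      (∀ p > 0, Tendsto (Stratification.phi p) (𝓝[<] (Real.pi / 2)) (𝓝 (L p))) ∧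
      ∃ p₀ d₀ : ℝ,
        -- `p₀` is the only solution of the equation in `(A, B)`
        p₀ ∈ Ioo Stratification.A Stratification.B ∧
        (∀ p ∈ Ioo Stratification.A Stratification.B,
          (|Stratification.phi p (t p)| = L p ↔ p = p₀)) ∧
        0.072425 ≤ p₀ ∧ p₀ < 0.072426 ∧
        -- the common value `d₀` is the infimum of the errors
        d₀ = |Stratification.phi p₀ (t p₀)| ∧ d₀ = L p₀ ∧
        0.026471 ≤ d₀ ∧ d₀ < 0.026472 ∧
        (d₀ : EReal) = Stratification.infError Stratification.phi 0 (Real.pi / 2) ∧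
        Stratification.IsMinimaxApproximant Stratification.phi 0 (Real.pi / 2) p₀ := by
  choose! t ht hK using fun p ↦ exists_slopeSeries_eq (p := p)
  have ht2 : ∀ p ∈ Ioo A B, t p ∈ Ioo (0 : ℝ) 2 := fun p hp ↦ Ioo_pi_div_two_subset (ht p hp)
  have habs : ∀ p ∈ Ioo A B, |phi p (t p)| = -phi p (t p) := fun p hp ↦
    abs_of_nonpos (phi_nonpos (ht2 p hp) (hK p hp))
  have hmin : ∀ p ∈ Ioo A B, ∀ x ∈ Ioo 0 (Real.pi / 2), phi p (t p) ≤ phi p x := fun p hp x hx ↦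
    phi_min (ht2 p hp) (hK p hp) (Ioo_pi_div_two_subset hx)
  have hmono : ∀ p ∈ Ioo A B, ∀ q ∈ Ioo A B, p < q → phi q (t q) < phi p (t p) :=
    fun p hp q hq hpq ↦ (hmin q hq _ (ht p hp)).trans_lt ((phi_lt_phi (ht p hp).1).1 hpq)
  -- Compare both parameters at the same point t q; 16 = 2⁴ bounds its fourth power.
  have hlip : ∀ p ∈ Ioo A B, ∀ q ∈ Ioo A B, phi p (t p) ≤ phi q (t q) + 16 * |p - q| := by
    intro p hp q hq
    have h := hmin p hp _ (ht q hq)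
    have h4 : (t q) ^ 4 ≤ 2 ^ 4 := pow_le_pow_left₀ (ht2 q hq).1.le (ht2 q hq).2.le 4
    have h0 : 0 ≤ (t q) ^ 4 := by positivity
    rw [phi_eq p (t q)] at h
    rw [phi_eq q (t q)]
    nlinarith [neg_abs_le (p - q), mul_le_mul_of_nonneg_left h4 (abs_nonneg (p - q))]
  have hcont : ContinuousOn (fun p ↦ phi p (t p)) (Ioo A B) := by
    refine LipschitzOnWith.continuousOn (K := 16) (LipschitzOnWith.of_dist_le_mul fun p hp q hq ↦ ?_)
    rw [Real.dist_eq, Real.dist_eq, abs_le]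
    have h1 := hlip p hp q hq
    have h2 := hlip q hq p hp
    rw [abs_sub_comm q p] at h2
    norm_num
    constructor <;> linarith
  obtain ⟨p₀, hp₀, hzero⟩ : (0 : ℝ) ∈
      (fun p ↦ -phi p (t p) - endLimit p) '' Icc 0.0724252 0.072425285 := by
    refine intermediate_value_Icc (by norm_num) ?_ ⟨?_, ?_⟩
    · refine (hcont.mono fun p hp ↦ parameter_mem hp).neg.sub ?_
      unfold endLimit
      fun_prop
    · have hp := parameter_mem (p := 0.0724252) (by norm_num)
      exact (sub_neg.2 (neg_phi_lt_endLimit (ht _ hp))).le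
    · have hp := parameter_mem (p := 0.072425285) (by norm_num)
      have h := hmin _ hp 1.247008 ⟨by norm_num, by linarith [Real.pi_gt_three]⟩
      have := endLimit_lt_neg_phi
      change 0 ≤ -phi _ _ - endLimit _
      linarith
  have hAB := parameter_mem hp₀
  have heq : -phi p₀ (t p₀) = endLimit p₀ := sub_eq_zero.1 hzero
  have hpos : 0 < p₀ := lt_of_lt_of_le (by norm_num) hp₀.1
  have herr : error phi 0 (Real.pi / 2) p₀ = ((endLimit p₀ : ℝ) : EReal) := by
    refine le_antisymm (iSup₂_le fun x hx ↦ EReal.coe_le_coe_iff.2 (abs_le.2 ⟨?_, ?_⟩))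
      (endLimit_le_error p₀)
    · linarith [hmin p₀ hAB x hx]
    · exact phi_le_endLimit hAB.2.le hx
  -- A smaller p raises the end limit; a larger p lowers the value at t p₀ further below zero.
  have hgt : ∀ p, p ≠ p₀ → ((endLimit p₀ : ℝ) : EReal) < error phi 0 (Real.pi / 2) p := by
    intro p hne
    rcases hne.lt_or_gt with h | h
    · exact (EReal.coe_lt_coe_iff.2 (endLimit_lt h)).trans_le (endLimit_le_error p)
    · refine lt_of_lt_of_le (EReal.coe_lt_coe_iff.2 ?_) (abs_phi_le_error (ht p₀ hAB))
      have := (phi_lt_phi (ht p₀ hAB).1).1 h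
      linarith [neg_le_abs (phi p (t p₀))]
  have hinf : ((endLimit p₀ : ℝ) : EReal) = infError phi 0 (Real.pi / 2) := by
    refine le_antisymm (le_iInf₂ fun p _ ↦ ?_) (herr ▸ iInf₂_le p₀ hpos)
    rcases eq_or_ne p p₀ with rfl | h
    · exact herr.ge
    · exact (hgt p h).le
  have hb := endLimit_bounds hp₀
  refine ⟨fun x hx p _ q _ ↦ phi_lt_phi hx.1, t, endLimit,
    fun p hp ↦ isOnlyExtremumAndMin_phi (ht p hp) (hK p hp), fun p _ ↦ tendsto_phi p,
    p₀, endLimit p₀, hAB, fun p hp ↦ ⟨fun h ↦ ?_, ?_⟩, ?_, ?_, ?_, rfl, hb.1, hb.2, hinf, hpos,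
    fun p _ ↦ ⟨fun h ↦ ?_, ?_⟩⟩
  · rw [habs p hp] at h
    by_contra hne
    rcases lt_or_gt_of_ne hne with hlt | hlt
    · linarith [hmono p hp p₀ hAB hlt, endLimit_lt hlt]
    · linarith [hmono p₀ hAB p hp hlt, endLimit_lt hlt]
  · rintro rfl
    rw [habs p hp, heq]
  · exact le_trans (by norm_num) hp₀.1
  · exact lt_of_le_of_lt hp₀.2 (by norm_num)
  · rw [habs p₀ hAB, heq]
  · by_contra hne
    exact (hgt p hne).ne' (h.trans hinf.symm)
  · rintro rfl
    exact herr.trans hinf
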